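/- Let $\Phi$ be a reduced crystallographic root system of type $A_n$, with $n\ge 4$, spanning a Euclidean space $(V,(\cdot,\cdot))$ (whose reflections are the orthogonal reflections in the hyperplanes orthogonal to the roots). Let $\alpha_1,\dots,\alpha_n$ be simple roots, numbered along the Dynkin diagram, and let $\alpha_0$ be the highest root. Call $\alpha_j$ minuscule if its coefficient in $\alpha_0$ is $1$ (in type $A_n$ every simple root is minuscule). Let $$\mathcal A=\{x\in V\mid (\alpha_i,x)\ge 0 \text{ for } 1\le i\le n,\ (\alpha_0,x)\le 1\},$$ $$\mathcal K=\{x\in\mathcal A\mid (\alpha_0+\alpha_j,x)\le 1\text{ for all minuscule }\alpha_j\},$$ $$v_0=\sum_{i=1}^{\lfloor n/2\rfloor}(\alpha_i-\alpha_{n+1-i}),\qquad \mathcal L=\{x\in\mathcal K\mid (v_0,x)\ge 0\}.$$ A bounding hyperplane of a polytope $\mathcal P\subseteq V$ is an affine hyperplane $H$ of $V$ such that $\mathcal P$ lies in exactly one of the two closed half-spaces bounded by $H$ and $\mathcal P\cap H$ has codimension $1$ in $V$. Then $\mathcal K$ has exactly $2n$ bounding hyperplanes, namely $\{x\mid(\alpha_i,x)=0\}$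 and $\{x\mid(\alpha_0+\alpha_i,x)=1\}$ for $1\le i\le n$, and the bounding hyperplanes of $\mathcal L$ are precisely these $2n$ hyperplanes together with $\{x\in V\mid (v_0,x)=0\}$. -/

import Mathlib

open scoped InnerProductSpace

noncomputable section

namespace AlcoveSlice

variable {V : Type*} [NormedAddCommGroup V] [InnerProductSpace ℝ V]

/-- A root pairing of a Euclidean space `V` with itself is Euclidean if the pairing is the inner
product and every coroot is `2 α / (α, α)`, so that the reflections of the root pairing are the
orthogonal reflections in the hyperplanes orthogonal to the roots. -/
def IsEuclidean {ι : Type*} (P : RootPairing ι ℝ V V) : Prop :=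
  (∀ x y : V, P.toLinearMap x y = ⟪x, y⟫_ℝ) ∧
    ∀ i, P.coroot i = (2 / ⟪P.root i, P.root i⟫_ℝ) • P.root i

/-- The root of index `θ` is the highest root with respect to the base `b`: its difference with
any root is a sum of simple roots. -/
def IsHighestRoot {ι : Type*} {P : RootPairing ι ℝ V V} (b : P.Base) (θ : ι) : Prop :=
  ∀ i, P.root θ - P.root i ∈ AddSubmonoid.closure (P.root '' b.support)

/-- A simple root is minuscule if its coefficient in the highest root is `1`. -/
def IsMinuscule {ι : Type*} {P : RootPairing ι ℝ V V} [P.IsRootSystem] (b : P.Base) (θ : ι)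
    (j : b.support) : Prop :=
  b.toWeightBasis.repr (P.root θ) j = 1

/-- The fundamental alcove. -/
def alcove {ι : Type*} {P : RootPairing ι ℝ V V} (b : P.Base) (θ : ι) : Set V :=
  {x | (∀ i ∈ b.support, 0 ≤ ⟪P.root i, x⟫_ℝ) ∧ ⟪P.root θ, x⟫_ℝ ≤ 1}

/-- The Komrakov--Premet polytope. -/
def kpPolytope {ι : Type*} {P : RootPairing ι ℝ V V} [P.IsRootSystem] (b : P.Base) (θ : ι) :
    Set V :=
  {x | x ∈ alcove b θ ∧
    ∀ j : b.support, IsMinuscule b θ j → ⟪P.root θ + P.root j, x⟫_ℝ ≤ 1}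

/-- The vector `∑ (α_i - α_{n+1-i})`, sum over `1 ≤ i ≤ ⌊n/2⌋`. The simple roots are numbered from
`0` here, so that `α_i` is `α ⟨i - 1, _⟩` and `i ↦ n + 1 - i` is `Fin.rev`. -/
def balancedRoot {n : ℕ} (α : Fin n → V) : V :=
  ∑ i : Fin n with i.val + 1 ≤ n / 2, (α i - α i.rev)

/-- The part of a set on the nonnegative side of the hyperplane orthogonal to `v`. -/
def slice (K : Set V) (v : V) : Set V :=
  {x | x ∈ K ∧ 0 ≤ ⟪v, x⟫_ℝ}

/-- The affine hyperplane `(v, x) = c` (for `v ≠ 0`). -/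
def hyperplane (v : V) (c : ℝ) : Set V :=
  {x | ⟪v, x⟫_ℝ = c}

/-- The bounding hyperplanes of `K`: the affine hyperplanes `H` of `V` such that `K` lies in exactly
one of the two closed half-spaces bounded by `H` and `K ∩ H` has codimension one in `V`. (Since
`(v, c)` may be replaced by `(-v, -c)`, the half-space containing `K` is taken
to be `(v, x) ≤ c`.) -/
def boundingHyperplanes (K : Set V) : Set (Set V) :=
  {H | ∃ (v : V) (c : ℝ), v ≠ 0 ∧ H = hyperplane v c ∧
    (∀ x ∈ K, ⟪v, x⟫_ℝ ≤ c) ∧ ¬ (∀ x ∈ K, c ≤ ⟪v, x⟫_ℝ) ∧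
    (K ∩ H).Nonempty ∧
    Module.finrank ℝ (affineSpan ℝ (K ∩ H)).direction + 1 = Module.finrank ℝ V}

end AlcoveSlice

end

/-! In type A the highest root is the sum of the simple roots (`highestRoot_eq_sum`), so in the
coordinates y i = (α i, x), which are free because the simple roots form a basis, K is cut out by y
i ≥ 0 and ∑ y + y i ≤ 1; the alcove inequality ∑ y ≤ 1 then follows. The slice adds one more linear
inequality.

By `boundingHyperplanes_polyhedron` it suffices to exhibit an interior point and, for each
inequality, a point where it alone is an equality. Those found for L also serve K. They are rescaled
perturbations of the weights (3, 3, 1, …, 1): the balanced form is at least 4 there, and a change of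
one weight by at most 3 leaves it positive. The facet on the slicing hyperplane uses constant
weights. -/

namespace AlcoveSlice

open scoped InnerProductSpace
open Module

/-! ### Facets of polyhedra given by finitely many inequalities -/

section Polyhedron

variable {V : Type*} [NormedAddCommGroup V] [InnerProductSpace ℝ V]

/-- The intersection of the closed half-spaces `(v k, x) ≤ c k`. -/
def polyhedron {κ : Type*} (v : κ → V) (c : κ → ℝ) : Set V :=
  {x | ∀ k, ⟪v k, x⟫_ℝ ≤ c k}

lemma finrank_orthogonal_span_singleton_add_one [FiniteDimensional ℝ V] {v : V} (hv : v ≠ 0) :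
    finrank ℝ (ℝ ∙ v)ᗮ + 1 = finrank ℝ V := by
  rw [← (ℝ ∙ v).finrank_add_finrank_orthogonal, finrank_span_singleton hv, add_comm]

lemma direction_affineSpan_le_orthogonal {s : Set V} {v : V} {c : ℝ}
    (hs : s ⊆ hyperplane v c) : (affineSpan ℝ s).direction ≤ (ℝ ∙ v)ᗮ := by
  rw [direction_affineSpan, vectorSpan_def, Submodule.span_le]
  rintro _ ⟨x, hx, y, hy, rfl⟩
  have hx := hs hx
  have hy := hs hy
  simp only [hyperplane, Set.mem_ofPred_eq] at hx hy
  simp [Submodule.mem_orthogonal_singleton_iff_inner_right, inner_sub_right, hx, hy]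

lemma hyperplane_eq_of_orthogonal_eq {v w x : V} {c d : ℝ} (h : (ℝ ∙ v)ᗮ = (ℝ ∙ w)ᗮ)
    (hv : x ∈ hyperplane v c) (hw : x ∈ hyperplane w d) : hyperplane v c = hyperplane w d := by
  ext y
  have := SetLike.ext_iff.1 h (y - x)
  simp only [hyperplane, Set.mem_ofPred_eq] at hv hw
  simpa [Submodule.mem_orthogonal_singleton_iff_inner_right, inner_sub_right, hv, hw,
    sub_eq_zero, hyperplane] using this

/-- Near a point, strict linear inequalities persist in every direction. -/
lemma exists_pos_forall_inner_add_smul_le {κ : Type*} [Finite κ] (v : κ → V) (c : κ → ℝ)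
    (q u : V) (h : ∀ k, ⟪v k, q⟫_ℝ < c k ∨ ⟪v k, q⟫_ℝ = c k ∧ ⟪v k, u⟫_ℝ = 0) :
    ∃ t : ℝ, 0 < t ∧ q + t • u ∈ polyhedron v c := by
  -- The one-sided filter makes the eventual `t` positive.
  have key : ∀ k, ∀ᶠ t : ℝ in nhdsWithin 0 (Set.Ioi 0), ⟪v k, q + t • u⟫_ℝ ≤ c k := by
    intro k
    rcases h k with hk | ⟨hk, hu⟩
    · have hc : Continuous fun t : ℝ => ⟪v k, q + t • u⟫_ℝ := by fun_prop
      have : ∀ᶠ t : ℝ in nhds 0, ⟪v k, q + t • u⟫_ℝ < c k :=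
        hc.continuousAt.eventually_lt continuousAt_const (by simpa using hk)
      exact (this.filter_mono nhdsWithin_le_nhds).mono fun t ht => ht.le
    · refine Filter.Eventually.of_forall fun t => ?_
      simp [inner_add_right, inner_smul_right, hk, hu]
  obtain ⟨t, ht, hpos⟩ := ((Filter.eventually_all.2 key).and self_mem_nhdsWithin).exists
  exact ⟨t, hpos, ht⟩

/-- A small move from `q` along any vector orthogonal to `v k` stays in the face, so the face spans
its whole hyperplane. -/
lemma orthogonal_le_direction_of_facet_point {κ : Type*} [Finite κ] {v : κ → V} {c : κ → ℝ}
    {k : κ} {q : V} (hq : ⟪v k, q⟫_ℝ = c k) (hlt : ∀ l, l ≠ k → ⟪v l, q⟫_ℝ < c l) :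
    (ℝ ∙ v k)ᗮ ≤ (affineSpan ℝ (polyhedron v c ∩ hyperplane (v k) (c k))).direction := by
  intro u hu
  rw [Submodule.mem_orthogonal_singleton_iff_inner_right] at hu
  have hqK : q ∈ polyhedron v c ∩ hyperplane (v k) (c k) := by
    refine ⟨fun l => ?_, hq⟩
    by_cases hl : l = k
    · exact hl ▸ hq.le
    · exact (hlt l hl).le
  obtain ⟨t, ht, htK⟩ := exists_pos_forall_inner_add_smul_le v c q u fun l => by
    by_cases hl : l = k
    · exact Or.inr (hl ▸ ⟨hq, hu⟩)
    · exact Or.inl (hlt l hl)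
  have htH : q + t • u ∈ polyhedron v c ∩ hyperplane (v k) (c k) :=
    ⟨htK, by simp [hyperplane, inner_add_right, inner_smul_right, hq, hu]⟩
  have := AffineSubspace.vsub_mem_direction (subset_affineSpan ℝ _ htH)
    (subset_affineSpan ℝ _ hqK)
  rw [vsub_eq_sub, add_sub_cancel_left] at this
  exact (Submodule.smul_mem_iff _ ht.ne').1 this

/-- A supporting hyperplane meets a polyhedron inside one of the defining hyperplanes. -/
lemma exists_inter_hyperplane_subset {κ : Type*} [Finite κ] {v : κ → V} {c : κ → ℝ}
    {w : V} {d : ℝ} (hw : w ≠ 0) (hle : ∀ x ∈ polyhedron v c, ⟪w, x⟫_ℝ ≤ d)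
    (hne : (polyhedron v c ∩ hyperplane w d).Nonempty) :
    ∃ k, polyhedron v c ∩ hyperplane w d ⊆ hyperplane (v k) (c k) := by
  by_contra! hcon
  have hx : ∀ k, ∃ x, x ∈ polyhedron v c ∩ hyperplane w d ∧ ⟪v k, x⟫_ℝ < c k := by
    intro k
    obtain ⟨x, hx, hxk⟩ := Set.not_subset.1 (hcon k)
    exact ⟨x, hx, lt_of_le_of_ne (hx.1 k) hxk⟩
  choose x hxmem hxlt using hx
  -- The average of the `x k` is strict in every inequality; a small move along `w` then stays in
  -- the polyhedron but violates `hle`.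
  obtain ⟨q, hq, hqlt⟩ : ∃ q, q ∈ hyperplane w d ∧ ∀ k, ⟪v k, q⟫_ℝ < c k := by
    cases isEmpty_or_nonempty κ with
    | inl _ => exact ⟨hne.some, hne.some_mem.2, fun k => isEmptyElim k⟩
    | inr _ =>
      have := Fintype.ofFinite κ
      have hN : (0 : ℝ) < Fintype.card κ := by exact_mod_cast Fintype.card_pos
      refine ⟨(Fintype.card κ : ℝ)⁻¹ • ∑ k, x k, ?_, fun l => ?_⟩
      · have : ∀ k, ⟪w, x k⟫_ℝ = d := fun k => (hxmem k).2
        simp [hyperplane, inner_smul_right, inner_sum, this, hN.ne']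
      · have : ∑ k, ⟪v l, x k⟫_ℝ < ∑ _k : κ, c l :=
          Finset.sum_lt_sum (fun k _ => (hxmem k).1 l) ⟨l, Finset.mem_univ l, hxlt l⟩
        rw [inner_smul_right, inner_sum, inv_mul_lt_iff₀ hN]
        simpa using this
  obtain ⟨t, ht, htK⟩ := exists_pos_forall_inner_add_smul_le v c q w fun k => Or.inl (hqlt k)
  have h1 := hle _ htK
  have h2 : ⟪w, q⟫_ℝ = d := hq
  have h3 : 0 < ⟪w, w⟫_ℝ := real_inner_self_pos.2 hw
  rw [inner_add_right, inner_smul_right, h2] at h1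
  nlinarith [mul_pos ht h3]

/-- If a polyhedron has an interior point and every defining hyperplane has a point at which all
other inequalities are strict, then the defining hyperplanes are its bounding hyperplanes. -/
theorem boundingHyperplanes_polyhedron [FiniteDimensional ℝ V] {κ : Type*} [Finite κ]
    {v : κ → V} {c : κ → ℝ} {p : V} (hp : ∀ k, ⟪v k, p⟫_ℝ < c k)
    (hq : ∀ k, ∃ q, ⟪v k, q⟫_ℝ = c k ∧ ∀ l, l ≠ k → ⟪v l, q⟫_ℝ < c l) :
    boundingHyperplanes (polyhedron v c) = Set.range fun k => hyperplane (v k) (c k) := by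
  have hv : ∀ k, v k ≠ 0 := by
    intro k hk
    obtain ⟨q, h, -⟩ := hq k
    have := hp k
    simp only [hk, inner_zero_left] at h this
    exact this.ne h
  ext H
  constructor
  · rintro ⟨w, d, hw, rfl, hle, -, hne, hdim⟩
    obtain ⟨k, hk⟩ := exists_inter_hyperplane_subset hw hle hne
    -- The face has codimension one and lies in both hyperplanes, so its direction is that of each;
    -- they also share a point.
    have e1 := Submodule.eq_of_le_of_finrank_eq
      (direction_affineSpan_le_orthogonal (Set.inter_subset_right
        (s := polyhedron v c) (t := hyperplane w d)))
      (by have := finrank_orthogonal_span_singleton_add_one hw; omega)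
    have e2 := Submodule.eq_of_le_of_finrank_eq (direction_affineSpan_le_orthogonal hk)
      (by have := finrank_orthogonal_span_singleton_add_one (hv k); omega)
    obtain ⟨x, hx⟩ := hne
    exact ⟨k, (hyperplane_eq_of_orthogonal_eq (e1.symm.trans e2) hx.2 (hk hx)).symm⟩
  · rintro ⟨k, rfl⟩
    obtain ⟨q, hqk, hql⟩ := hq k
    refine ⟨v k, c k, hv k, rfl, fun x hx => hx k, fun h => ?_, ⟨q, fun l => ?_, hqk⟩, ?_⟩
    · exact (hp k).not_ge (h p fun l => (hp l).le)
    · by_cases hl : l = k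
      · exact hl ▸ hqk.le
      · exact (hql l hl).le
    · rw [le_antisymm (direction_affineSpan_le_orthogonal Set.inter_subset_right)
        (orthogonal_le_direction_of_facet_point hqk hql)]
      exact finrank_orthogonal_span_singleton_add_one (hv k)

lemma injective_hyperplane_of_facet_points {κ : Type*} {v : κ → V} {c : κ → ℝ}
    (hq : ∀ k, ∃ q, ⟪v k, q⟫_ℝ = c k ∧ ∀ l, l ≠ k → ⟪v l, q⟫_ℝ < c l) :
    Function.Injective fun k => hyperplane (v k) (c k) := by
  intro k l h
  obtain ⟨q, hqk, hql⟩ := hq k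
  by_contra hkl
  have : q ∈ hyperplane (v l) (c l) := (Set.ext_iff.1 h q).1 hqk
  exact (hql l (Ne.symm hkl)).ne this

end Polyhedron

/-! ### The highest root in type A -/

section HighestRoot

variable {V : Type*} [NormedAddCommGroup V] [InnerProductSpace ℝ V]

namespace IsEuclidean

variable {ι : Type*} {P : RootPairing ι ℝ V V}

lemma pairing_mul (hP : IsEuclidean P) (i j : ι) :
    P.pairing i j * ⟪P.root j, P.root j⟫_ℝ = 2 * ⟪P.root i, P.root j⟫_ℝ := by
  have h0 : ⟪P.root j, P.root j⟫_ℝ ≠ 0 := inner_self_ne_zero.2 (P.ne_zero j)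
  rw [← P.root_coroot'_eq_pairing, RootPairing.coroot', LinearMap.flip_apply, hP.1, hP.2,
    inner_smul_right]
  field_simp

lemma inner_root_reflectionPerm_self (hP : IsEuclidean P) (i j : ι) :
    ⟪P.root (P.reflectionPerm j i), P.root (P.reflectionPerm j i)⟫_ℝ =
      ⟪P.root i, P.root i⟫_ℝ := by
  rw [P.root_reflectionPerm, P.reflection_apply_root, inner_sub_left, inner_sub_right,
    inner_sub_right, inner_smul_left, inner_smul_right, inner_smul_left, inner_smul_right,
    real_inner_comm (P.root i) (P.root j)]
  have := hP.pairing_mul i j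
  simp only [conj_trivial]
  linear_combination P.pairing i j * this

end IsEuclidean

/-- A root system of type `A` with numbered simple roots: the Gram matrix is a multiple of the
Cartan matrix. -/
lemma exists_inner_eq_cartanMatrix_A {ι : Type*} {P : RootPairing ι ℝ V V}
    [P.IsCrystallographic] (hP : IsEuclidean P) (b : P.Base) {n : ℕ} (hn : 0 < n)
    (e : Fin n ≃ b.support) (hA : ∀ i j, b.cartanMatrix (e i) (e j) = CartanMatrix.A n i j) :
    ∃ L : ℝ, 0 < L ∧
      ∀ i j, 2 * ⟪P.root (e i), P.root (e j)⟫_ℝ = (CartanMatrix.A n i j : ℝ) * L := by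
  have hpair : ∀ i j, P.pairing (e i) (e j) = (CartanMatrix.A n i j : ℝ) := by
    intro i j
    rw [← hA]
    exact (b.algebraMap_cartanMatrixIn_apply ℤ (e i) (e j)).symm
  -- Neighbours pair to -1 in both orders, hence have equal length.
  have hlen : ∀ (m : ℕ) (hm : m < n), ⟪P.root (e ⟨m, hm⟩), P.root (e ⟨m, hm⟩)⟫_ℝ =
      ⟪P.root (e ⟨0, hn⟩), P.root (e ⟨0, hn⟩)⟫_ℝ := by
    intro m
    induction m with
    | zero => intro _; rfl
    | succ m ih =>
      intro hm
      rw [← ih (by omega)]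
      have h1 := hP.pairing_mul (e ⟨m, by omega⟩) (e ⟨m + 1, hm⟩)
      have h2 := hP.pairing_mul (e ⟨m + 1, hm⟩) (e ⟨m, by omega⟩)
      rw [hpair, real_inner_comm (P.root (e ⟨m + 1, hm⟩)) (P.root (e ⟨m, by omega⟩))] at h1
      rw [hpair] at h2
      simp [CartanMatrix.A, -inner_self_eq_norm_sq_to_K] at h1 h2
      linarith
  refine ⟨_, real_inner_self_pos.2 (P.ne_zero (e ⟨0, hn⟩)), fun i j => ?_⟩
  rw [← hpair, ← hP.pairing_mul, hlen j.1 j.2]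

/-- A node has at most two neighbours. This makes the sum of the simple roots dominant. -/
lemma sum_cartanMatrix_A_nonneg (n : ℕ) (i : Fin n) : 0 ≤ ∑ j, CartanMatrix.A n i j := by
  have h : ∀ j, CartanMatrix.A n i j = (if i = j then 2 else 0) -
      (if i.val + 1 = j.val then 1 else 0) - (if j.val + 1 = i.val then 1 else 0) := by
    intro j
    simp only [CartanMatrix.A, Matrix.of_apply, Fin.ext_iff]
    split_ifs <;> omega
  have h1 : ∑ j : Fin n, (if i.val + 1 = j.val then (1 : ℤ) else 0) ≤ 1 := by
    rw [Finset.sum_boole]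
    exact_mod_cast Finset.card_le_one.2 fun a ha b hb => by
      simp only [Finset.mem_filter] at ha hb
      exact Fin.ext (by omega)
  have h2 : ∑ j : Fin n, (if j.val + 1 = i.val then (1 : ℤ) else 0) ≤ 1 := by
    rw [Finset.sum_boole]
    exact_mod_cast Finset.card_le_one.2 fun a ha b hb => by
      simp only [Finset.mem_filter] at ha hb
      exact Fin.ext (by omega)
  simp only [h, Finset.sum_sub_distrib, Finset.sum_ite_eq, Finset.mem_univ, if_true]
  omega

/-- Only the last summand of a partial sum meets the next simple root, so their pairing is -1 and
reflecting adds that simple root. -/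
lemma exists_root_eq_sum_le {ι : Type*} {P : RootPairing ι ℝ V V}
    [P.IsCrystallographic] (hP : IsEuclidean P) (b : P.Base) {n : ℕ}
    (e : Fin n ≃ b.support) (hA : ∀ i j, b.cartanMatrix (e i) (e j) = CartanMatrix.A n i j)
    (m : ℕ) (hm : m < n) : ∃ r, P.root r = ∑ i : Fin n with i.val ≤ m, P.root (e i) := by
  obtain ⟨L, hL, hG⟩ := exists_inner_eq_cartanMatrix_A hP b (by omega) e hA
  induction m with
  | zero =>
    refine ⟨e ⟨0, hm⟩, ?_⟩
    rw [Finset.sum_eq_single_of_mem (⟨0, hm⟩ : Fin n) (by simp)]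
    intro i hi hne
    simp only [Finset.mem_filter, Finset.mem_univ, true_and] at hi
    exact absurd (Fin.ext (by simpa using hi)) hne
  | succ m ih =>
    obtain ⟨r, hr⟩ := ih (by omega)
    have hfil : (Finset.univ.filter fun i : Fin n => i.val ≤ m + 1) =
        insert ⟨m + 1, hm⟩ (Finset.univ.filter fun i : Fin n => i.val ≤ m) := by
      ext i
      simp only [Finset.mem_filter, Finset.mem_univ, true_and, Finset.mem_insert, Fin.ext_iff]
      omega
    have hin : 2 * ⟪P.root r, P.root (e ⟨m + 1, hm⟩)⟫_ℝ = -L := by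
      rw [hr, sum_inner, Finset.mul_sum,
        Finset.sum_eq_single_of_mem (⟨m, by omega⟩ : Fin n) (by simp)]
      · rw [hG]
        simp [CartanMatrix.A]
      · intro i hi hne
        simp only [Finset.mem_filter, Finset.mem_univ, true_and] at hi
        rw [ne_eq, Fin.ext_iff] at hne
        simp only at hne
        rw [hG, CartanMatrix.A, Matrix.of_apply, if_neg (by rw [Fin.ext_iff]; simp; omega),
          if_neg (by simp; omega)]
        simp
    have hself := hG ⟨m + 1, hm⟩ ⟨m + 1, hm⟩
    have hpair := hP.pairing_mul r (e ⟨m + 1, hm⟩)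
    have hp : P.pairing r (e ⟨m + 1, hm⟩) = -1 := by
      simp [CartanMatrix.A, -inner_self_eq_norm_sq_to_K] at hself
      rw [hin, hself] at hpair
      have : (P.pairing r (e ⟨m + 1, hm⟩) + 1) * L = 0 := by linarith
      have := (mul_eq_zero.1 this).resolve_right hL.ne'
      linarith
    refine ⟨P.reflectionPerm (e ⟨m + 1, hm⟩) r, ?_⟩
    rw [P.root_reflectionPerm, P.reflection_apply_root, hp, hfil,
      Finset.sum_insert (by simp), ← hr]
    simp [add_comm]

/-- In type `A` the highest root is the sum of the simple roots. -/
theorem highestRoot_eq_sum {ι : Type*} [Finite ι] {P : RootPairing ι ℝ V V}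
    [P.IsCrystallographic] [P.IsReduced] (hP : IsEuclidean P) (b : P.Base) {n : ℕ} (hn : 0 < n)
    (e : Fin n ≃ b.support) (hA : ∀ i j, b.cartanMatrix (e i) (e j) = CartanMatrix.A n i j)
    {θ : ι} (hθ : IsHighestRoot b θ) : P.root θ = ∑ i, P.root (e i) := by
  obtain ⟨L, hL, hG⟩ := exists_inner_eq_cartanMatrix_A hP b hn e hA
  have hlen : ∀ r, ⟪P.root r, P.root r⟫_ℝ = L := by
    intro r
    refine b.induction_reflect r (p := fun r => ⟪P.root r, P.root r⟫_ℝ = L) ?_ ?_ ?_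
    · intro i hi
      rw [hP.inner_root_reflectionPerm_self, hi]
    · intro i hi
      have := hG (e.symm ⟨i, hi⟩) (e.symm ⟨i, hi⟩)
      simp [CartanMatrix.A, -inner_self_eq_norm_sq_to_K] at this
      simpa using this
    · intro i j hi _
      rw [hP.inner_root_reflectionPerm_self, hi]
  obtain ⟨s, hs⟩ := exists_root_eq_sum_le hP b e hA (n - 1) (by omega)
  rw [Finset.filter_true_of_mem (fun i _ => by omega)] at hs
  rw [← hs]
  have hdom : 0 ≤ ⟪P.root θ - P.root s, P.root s⟫_ℝ := by
    refine AddSubmonoid.closure_induction (motive := fun x _ => 0 ≤ ⟪x, P.root s⟫_ℝ)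
      ?_ (by simp) (fun x y _ _ hx hy => by rw [inner_add_left]; positivity) (hθ s)
    rintro _ ⟨i, hi, rfl⟩
    have h1 : 2 * ⟪P.root i, P.root s⟫_ℝ =
        ((∑ j, CartanMatrix.A n (e.symm ⟨i, hi⟩) j : ℤ) : ℝ) * L := by
      rw [hs, inner_sum, Finset.mul_sum, Int.cast_sum, Finset.sum_mul]
      refine Finset.sum_congr rfl fun j _ => ?_
      rw [← hG]
      simp
    have h2 : (0 : ℝ) ≤ ((∑ j, CartanMatrix.A n (e.symm ⟨i, hi⟩) j : ℤ) : ℝ) :=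
      Int.cast_nonneg (sum_cartanMatrix_A_nonneg _ _)
    have := mul_nonneg h2 hL.le
    change 0 ≤ ⟪P.root i, P.root s⟫_ℝ
    linarith
  -- Both roots have squared length `L`, and `hdom` says (θ, s) ≥ L: the equality case of
  -- Cauchy–Schwarz.
  have hle : ⟪P.root θ - P.root s, P.root θ - P.root s⟫_ℝ ≤ 0 := by
    rw [inner_sub_left, hlen] at hdom
    rw [inner_sub_left, inner_sub_right, inner_sub_right, hlen, hlen,
      real_inner_comm (P.root θ) (P.root s)]
    linarith
  exact sub_eq_zero.1 (real_inner_self_nonpos.1 hle)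

end HighestRoot

/-! ### Explicit facet points in coordinates -/

section Coordinates

lemma exists_forall_inner_basis_eq {V : Type*} [NormedAddCommGroup V] [InnerProductSpace ℝ V]
    [FiniteDimensional ℝ V] {κ : Type*} (B : Basis κ ℝ V) (y : κ → ℝ) :
    ∃ x : V, ∀ i, ⟪B i, x⟫_ℝ = y i := by
  refine ⟨(InnerProductSpace.toDual ℝ V).symm (B.constr ℝ y).toContinuousLinearMap, fun i => ?_⟩
  rw [real_inner_comm, InnerProductSpace.toDual_symm_apply]
  simp

/-- The coordinate form of the pairing with `balancedRoot`. -/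
def balancedForm {n : ℕ} (y : Fin n → ℝ) : ℝ :=
  ∑ i : Fin n with i.val + 1 ≤ n / 2, (y i - y i.rev)

lemma inner_balancedRoot {V : Type*} [NormedAddCommGroup V] [InnerProductSpace ℝ V]
    {n : ℕ} (α : Fin n → V) (x : V) :
    ⟪balancedRoot α, x⟫_ℝ = balancedForm fun i => ⟪α i, x⟫_ℝ := by
  simp [balancedRoot, balancedForm, sum_inner, inner_sub_left]

/-- Weights equal to `3` at the first two indices and `1` elsewhere. -/
def baseWeight {n : ℕ} (i : Fin n) : ℝ := if i.val < 2 then 3 else 1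

/-- `baseWeight` with the value at `j` shifted by `u`. -/
def shiftedWeight {n : ℕ} (j : Fin n) (u : ℝ) (i : Fin n) : ℝ :=
  baseWeight i + if i = j then u else 0

lemma one_le_baseWeight {n : ℕ} (i : Fin n) : 1 ≤ baseWeight i := by
  unfold baseWeight; split_ifs <;> norm_num

lemma baseWeight_le_three {n : ℕ} (i : Fin n) : baseWeight i ≤ 3 := by
  unfold baseWeight; split_ifs <;> norm_num

lemma shiftedWeight_self {n : ℕ} (j : Fin n) (u : ℝ) :
    shiftedWeight j u j = baseWeight j + u := by
  simp [shiftedWeight]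

lemma shiftedWeight_of_ne {n : ℕ} {i j : Fin n} (h : i ≠ j) (u : ℝ) :
    shiftedWeight j u i = baseWeight i := by
  simp [shiftedWeight, h]

lemma four_le_balancedForm_baseWeight {n : ℕ} (hn : 4 ≤ n) :
    4 ≤ balancedForm (baseWeight (n := n)) := by
  -- Here n ≥ 4 enters: both heavy indices lie in the first half, and each contributes 3 - 1.
  have hsub : ({⟨0, by omega⟩, ⟨1, by omega⟩} : Finset (Fin n)) ⊆
      Finset.univ.filter fun i : Fin n => i.val + 1 ≤ n / 2 := by
    intro i hi
    simp only [Finset.mem_insert, Finset.mem_singleton, Fin.ext_iff] at hi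
    simp only [Finset.mem_filter, Finset.mem_univ, true_and]
    omega
  have hrev : ∀ i : Fin n, i.val + 1 ≤ n / 2 → baseWeight i.rev = 1 := by
    intro i hi
    rw [baseWeight, if_neg (by rw [Fin.val_rev]; omega)]
  unfold balancedForm
  refine le_trans ?_ (Finset.sum_le_sum_of_subset_of_nonneg hsub fun i hi _ => ?_)
  · rw [Finset.sum_pair (by simp [Fin.ext_iff]), hrev _ (by simp; omega), hrev _ (by simp; omega)]
    norm_num [baseWeight]
  · simp only [Finset.mem_filter, Finset.mem_univ, true_and] at hi
    rw [hrev i hi]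
    linarith [one_le_baseWeight i]

lemma balancedForm_shiftedWeight_pos {n : ℕ} (hn : 4 ≤ n) (j : Fin n) {u : ℝ} (hu : |u| ≤ 3) :
    0 < balancedForm (shiftedWeight j u) := by
  -- The form changes by `u`, `-u` or 0, according to the half containing `j`.
  have hsum : balancedForm (shiftedWeight j u) = balancedForm (baseWeight (n := n)) +
      ((if j.val + 1 ≤ n / 2 then u else 0) - (if j.rev.val + 1 ≤ n / 2 then u else 0)) := by
    have hrev : ∀ i : Fin n, i.rev = j ↔ i = j.rev := fun i => Fin.rev_eq_iff
    simp only [balancedForm, shiftedWeight, hrev, add_sub_add_comm, Finset.sum_add_distrib,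
      Finset.sum_sub_distrib, Finset.sum_ite_eq', Finset.mem_filter, Finset.mem_univ, true_and]
  have := four_le_balancedForm_baseWeight hn
  have := abs_le.1 hu
  rw [hsum, Fin.val_rev]
  split_ifs <;> linarith

lemma balancedForm_smul {n : ℕ} (s : ℝ) (y : Fin n → ℝ) :
    balancedForm (fun i => s * y i) = s * balancedForm y := by
  simp only [balancedForm, Finset.mul_sum, mul_sub]

/-- A scaling of nonnegative weights that makes all inequalities `∑ y + y i ≤ 1` strict. -/
lemma exists_scale_sum_add_lt_one {n : ℕ} {w : Fin n → ℝ} (hw : ∀ i, 0 ≤ w i) :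
    ∃ s : ℝ, 0 < s ∧ ∀ i, ∑ k, s * w k + s * w i < 1 := by
  have hS : 0 ≤ ∑ k, w k := Finset.sum_nonneg fun k _ => hw k
  -- Each ∑ w + w i is at most 2 ∑ w; the extra 1 gives strictness and a positive denominator.
  refine ⟨(2 * ∑ k, w k + 1)⁻¹, by positivity, fun i => ?_⟩
  have hi : w i ≤ ∑ k, w k := Finset.single_le_sum (fun k _ => hw k) (Finset.mem_univ i)
  rw [← Finset.mul_sum, ← mul_add, inv_mul_lt_iff₀ (by positivity)]
  linarith

lemma exists_coordinates_interior {n : ℕ} (hn : 4 ≤ n) :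
    ∃ y : Fin n → ℝ, (∀ i, 0 < y i) ∧ (∀ i, ∑ k, y k + y i < 1) ∧ 0 < balancedForm y := by
  have hw : ∀ i : Fin n, 0 < baseWeight i := fun i => by linarith [one_le_baseWeight i]
  obtain ⟨s, hs, h⟩ := exists_scale_sum_add_lt_one fun i => (hw i).le
  refine ⟨fun i => s * baseWeight i, fun i => mul_pos hs (hw i), h, ?_⟩
  rw [balancedForm_smul]
  exact mul_pos hs (by linarith [four_le_balancedForm_baseWeight hn])

lemma exists_coordinates_simple_facet {n : ℕ} (hn : 4 ≤ n) (j : Fin n) :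
    ∃ y : Fin n → ℝ, y j = 0 ∧ (∀ i, i ≠ j → 0 < y i) ∧ (∀ i, ∑ k, y k + y i < 1) ∧
      0 < balancedForm y := by
  set w := shiftedWeight j (-baseWeight j) with hwdef
  have hj : w j = 0 := by rw [hwdef, shiftedWeight_self, add_neg_cancel]
  have hne : ∀ i, i ≠ j → 0 < w i := fun i hi => by
    rw [hwdef, shiftedWeight_of_ne hi]; linarith [one_le_baseWeight i]
  have hw : ∀ i, 0 ≤ w i := fun i => by
    by_cases hi : i = j
    · rw [hi, hj]
    · exact (hne i hi).le
  obtain ⟨s, hs, h⟩ := exists_scale_sum_add_lt_one hw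
  refine ⟨fun i => s * w i, by simp [hj], fun i hi => mul_pos hs (hne i hi), h, ?_⟩
  rw [balancedForm_smul]
  refine mul_pos hs (balancedForm_shiftedWeight_pos hn j ?_)
  rw [abs_le]
  constructor <;> linarith [one_le_baseWeight j, baseWeight_le_three j]

lemma exists_coordinates_highest_facet {n : ℕ} (hn : 4 ≤ n) (j : Fin n) :
    ∃ y : Fin n → ℝ, (∀ i, 0 < y i) ∧ ∑ k, y k + y j = 1 ∧
      (∀ i, i ≠ j → ∑ k, y k + y i < 1) ∧ 0 < balancedForm y := by
  -- The value 4 makes `j` the unique maximum, with a shift of 1 or 3.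
  set w := shiftedWeight j (4 - baseWeight j) with hwdef
  have hj : w j = 4 := by rw [hwdef, shiftedWeight_self]; ring
  have hne : ∀ i, i ≠ j → w i = baseWeight i := fun i hi => by
    rw [hwdef, shiftedWeight_of_ne hi]
  have hw : ∀ i, 0 < w i := fun i => by
    by_cases hi : i = j
    · rw [hi, hj]; norm_num
    · rw [hne i hi]; linarith [one_le_baseWeight i]
  have hS : 0 ≤ ∑ k, w k := Finset.sum_nonneg fun k _ => (hw k).le
  have hT : 0 < ∑ k, w k + 4 := by positivity
  refine ⟨fun i => (∑ k, w k + 4)⁻¹ * w i, fun i => mul_pos (inv_pos.2 hT) (hw i), ?_, ?_, ?_⟩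
  · rw [← Finset.mul_sum, ← mul_add, hj, inv_mul_cancel₀ hT.ne']
  · intro i hi
    rw [← Finset.mul_sum, ← mul_add, inv_mul_lt_iff₀ hT, hne i hi]
    linarith [baseWeight_le_three i]
  · rw [balancedForm_smul]
    refine mul_pos (inv_pos.2 hT) (balancedForm_shiftedWeight_pos hn j ?_)
    rw [abs_le]
    constructor <;> linarith [one_le_baseWeight j, baseWeight_le_three j]

lemma exists_coordinates_balanced_facet (n : ℕ) :
    ∃ y : Fin n → ℝ, (∀ i, 0 < y i) ∧ (∀ i, ∑ k, y k + y i < 1) ∧ balancedForm y = 0 := by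
  obtain ⟨s, hs, h⟩ := exists_scale_sum_add_lt_one fun _ : Fin n => zero_le_one' ℝ
  exact ⟨fun _ => s * 1, fun _ => by simpa using hs, h, by simp [balancedForm]⟩

end Coordinates

/-! ### The polytopes as polyhedra -/

section Polytopes

variable {V : Type*} [NormedAddCommGroup V] [InnerProductSpace ℝ V]

/-- Normal vectors of the defining inequalities `-(α i, x) ≤ 0` and `(θ + α i, x) ≤ 1`. -/
def kpNormal {n : ℕ} (α : Fin n → V) : Fin n ⊕ Fin n → V :=
  Sum.elim (fun i => -α i) fun i => ∑ k, α k + α i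

/-- Right-hand sides of the defining inequalities `-(α i, x) ≤ 0` and `(θ + α i, x) ≤ 1`. -/
def kpBound {n : ℕ} : Fin n ⊕ Fin n → ℝ :=
  Sum.elim (fun _ => 0) fun _ => 1

/-- The normals of the Komrakov--Premet polytope together with that of the slicing half-space. -/
def sliceNormal {n : ℕ} (α : Fin n → V) (k : Option (Fin n ⊕ Fin n)) : V :=
  k.elim (-balancedRoot α) (kpNormal α)

/-- The bounds of the Komrakov--Premet polytope together with that of the slicing half-space. -/
def sliceBound {n : ℕ} (k : Option (Fin n ⊕ Fin n)) : ℝ :=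
  k.elim 0 kpBound

lemma hyperplane_neg_zero (v : V) : hyperplane (-v) 0 = hyperplane v 0 := by
  ext x; simp [hyperplane]

lemma range_kp_hyperplanes {n : ℕ} (α : Fin n → V) :
    (Set.range fun k => hyperplane (kpNormal α k) (kpBound k)) =
      (Set.range fun i => hyperplane (α i) 0) ∪
        Set.range fun i => hyperplane (∑ k, α k + α i) 1 := by
  ext H
  simp [kpNormal, kpBound, hyperplane_neg_zero]

lemma range_slice_hyperplanes {n : ℕ} (α : Fin n → V) :
    (Set.range fun k => hyperplane (sliceNormal α k) (sliceBound k)) =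
      (Set.range fun k => hyperplane (kpNormal α k) (kpBound k)) ∪
        {hyperplane (balancedRoot α) 0} := by
  ext H
  rw [Set.union_singleton]
  simp only [Set.mem_range, Option.exists, Set.mem_insert_iff, sliceNormal, sliceBound,
    Option.elim_none, Option.elim_some, hyperplane_neg_zero, eq_comm]

lemma slice_polyhedron {n : ℕ} (α : Fin n → V) :
    slice (polyhedron (kpNormal α) kpBound) (balancedRoot α) =
      polyhedron (sliceNormal α) sliceBound := by
  ext x
  simp [slice, polyhedron, Option.forall, sliceNormal, sliceBound, and_comm]

lemma mem_polyhedron_kpNormal_iff {n : ℕ} (α : Fin n → V) (x : V) :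
    x ∈ polyhedron (kpNormal α) kpBound ↔
      (∀ i, 0 ≤ ⟪α i, x⟫_ℝ) ∧ ∀ i, ⟪∑ k, α k + α i, x⟫_ℝ ≤ 1 := by
  simp [polyhedron, Sum.forall, kpNormal, kpBound]

lemma kpPolytope_eq_polyhedron {ι : Type*} {P : RootPairing ι ℝ V V} [P.IsRootSystem]
    (b : P.Base) {n : ℕ} (hn : 0 < n) (e : Fin n ≃ b.support) {θ : ι} {α : Fin n → V}
    (hα : ∀ i, α i = P.root (e i)) (hθ : P.root θ = ∑ i, α i) :
    kpPolytope b θ = polyhedron (kpNormal α) kpBound := by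
  have hmin : ∀ j, IsMinuscule b θ j := by
    intro j
    classical
    have h : ∀ i, α i = b.toWeightBasis (e i) := fun i => by rw [hα, b.toWeightBasis_apply]
    rw [IsMinuscule, hθ, map_sum, Finset.sum_apply']
    simp only [h, Basis.repr_self, Finsupp.single_apply, ← e.eq_symm_apply]
    simp
  ext x
  rw [mem_polyhedron_kpNormal_iff]
  constructor
  · rintro ⟨⟨h1, -⟩, h3⟩
    refine ⟨fun i => ?_, fun i => ?_⟩
    · rw [hα]; exact h1 _ (e i).2
    · rw [← hθ, hα]; exact h3 _ (hmin _)
  · rintro ⟨h1, h2⟩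
    refine ⟨⟨fun i hi => ?_, ?_⟩, fun j _ => ?_⟩
    · simpa [hα] using h1 (e.symm ⟨i, hi⟩)
    -- The alcove inequality is redundant: drop the nonnegative term from any one of the sharper
    -- inequalities.
    · have := h2 ⟨0, hn⟩
      rw [← hθ, inner_add_left] at this
      linarith [h1 ⟨0, hn⟩]
    · simpa [hα, hθ] using h2 (e.symm j)

variable [FiniteDimensional ℝ V]

lemma exists_slice_interior_point {n : ℕ} (hn : 4 ≤ n) (B : Basis (Fin n) ℝ V) :
    ∃ p, ∀ k, ⟪sliceNormal B k, p⟫_ℝ < sliceBound k := by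
  obtain ⟨y, h1, h2, h3⟩ := exists_coordinates_interior hn
  obtain ⟨p, hp⟩ := exists_forall_inner_basis_eq B y
  refine ⟨p, ?_⟩
  rintro (_ | i | i)
  · simpa [sliceNormal, sliceBound, inner_balancedRoot, hp] using h3
  · simpa [sliceNormal, sliceBound, kpNormal, kpBound, hp] using h1 i
  · simpa [sliceNormal, sliceBound, kpNormal, kpBound, inner_add_left, sum_inner, hp] using h2 i

lemma exists_slice_facet_point {n : ℕ} (hn : 4 ≤ n) (B : Basis (Fin n) ℝ V)
    (k : Option (Fin n ⊕ Fin n)) :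
    ∃ q, ⟪sliceNormal B k, q⟫_ℝ = sliceBound k ∧
      ∀ l, l ≠ k → ⟪sliceNormal B l, q⟫_ℝ < sliceBound l := by
  rcases k with _ | j | j
  · obtain ⟨y, h1, h2, h3⟩ := exists_coordinates_balanced_facet n
    obtain ⟨q, hq⟩ := exists_forall_inner_basis_eq B y
    refine ⟨q, by simpa [sliceNormal, sliceBound, inner_balancedRoot, hq] using h3, ?_⟩
    rintro (_ | i | i) hl
    · exact absurd rfl hl
    · simpa [sliceNormal, sliceBound, kpNormal, kpBound, hq] using h1 i
    · simpa [sliceNormal, sliceBound, kpNormal, kpBound, inner_add_left, sum_inner, hq] using h2 i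
  · obtain ⟨y, h0, h1, h2, h3⟩ := exists_coordinates_simple_facet hn j
    obtain ⟨q, hq⟩ := exists_forall_inner_basis_eq B y
    refine ⟨q, by simpa [sliceNormal, sliceBound, kpNormal, kpBound, hq] using h0, ?_⟩
    rintro (_ | i | i) hl
    · simpa [sliceNormal, sliceBound, inner_balancedRoot, hq] using h3
    · simpa [sliceNormal, sliceBound, kpNormal, kpBound, hq] using h1 i (by rintro rfl; simp at hl)
    · simpa [sliceNormal, sliceBound, kpNormal, kpBound, inner_add_left, sum_inner, hq] using h2 i
  · obtain ⟨y, h1, h0, h2, h3⟩ := exists_coordinates_highest_facet hn j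
    obtain ⟨q, hq⟩ := exists_forall_inner_basis_eq B y
    refine ⟨q, by simpa [sliceNormal, sliceBound, kpNormal, kpBound, inner_add_left, sum_inner, hq]
      using h0, ?_⟩
    rintro (_ | i | i) hl
    · simpa [sliceNormal, sliceBound, inner_balancedRoot, hq] using h3
    · simpa [sliceNormal, sliceBound, kpNormal, kpBound, hq] using h1 i
    · simpa [sliceNormal, sliceBound, kpNormal, kpBound, inner_add_left, sum_inner, hq] using
        h2 i (by rintro rfl; simp at hl)

lemma exists_kp_interior_point {n : ℕ} (hn : 4 ≤ n) (B : Basis (Fin n) ℝ V) :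
    ∃ p, ∀ k, ⟪kpNormal B k, p⟫_ℝ < kpBound k := by
  obtain ⟨p, hp⟩ := exists_slice_interior_point hn B
  exact ⟨p, fun k => hp (some k)⟩

lemma exists_kp_facet_point {n : ℕ} (hn : 4 ≤ n) (B : Basis (Fin n) ℝ V) (k : Fin n ⊕ Fin n) :
    ∃ q, ⟪kpNormal B k, q⟫_ℝ = kpBound k ∧ ∀ l, l ≠ k → ⟪kpNormal B l, q⟫_ℝ < kpBound l := by
  obtain ⟨q, hq, h⟩ := exists_slice_facet_point hn B (some k)
  exact ⟨q, hq, fun l hl => h (some l) (by simpa using hl)⟩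

end Polytopes

end AlcoveSlice

theorem mainTheorem11 {V : Type*} [NormedAddCommGroup V] [InnerProductSpace ℝ V]
    [FiniteDimensional ℝ V] {ι : Type*} [Finite ι]
    (P : RootPairing ι ℝ V V) [P.IsRootSystem] [P.IsCrystallographic] [P.IsReduced]
    (hP : AlcoveSlice.IsEuclidean P) (b : P.Base)
    (n : ℕ) (hn : 4 ≤ n) (e : Fin n ≃ b.support)
    (hA : ∀ i j, b.cartanMatrix (e i) (e j) = CartanMatrix.A n i j)
    (θ : ι) (hθ : AlcoveSlice.IsHighestRoot b θ)
    (α : Fin n → V) (hα : ∀ i, α i = P.root (e i)) :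
    AlcoveSlice.boundingHyperplanes (AlcoveSlice.kpPolytope b θ) =
        (Set.range fun i : Fin n => AlcoveSlice.hyperplane (α i) 0) ∪
          (Set.range fun i : Fin n => AlcoveSlice.hyperplane (P.root θ + α i) 1) ∧
      (AlcoveSlice.boundingHyperplanes (AlcoveSlice.kpPolytope b θ)).ncard = 2 * n ∧
      AlcoveSlice.boundingHyperplanes
          (AlcoveSlice.slice (AlcoveSlice.kpPolytope b θ) (AlcoveSlice.balancedRoot α)) =
        AlcoveSlice.boundingHyperplanes (AlcoveSlice.kpPolytope b θ) ∪
          {AlcoveSlice.hyperplane (AlcoveSlice.balancedRoot α) 0} := by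
  obtain ⟨B, hB⟩ : ∃ B : Module.Basis (Fin n) ℝ V, α = B :=
    ⟨b.toWeightBasis.reindex e.symm, funext fun i => by simp [hα]⟩
  have hθα : P.root θ = ∑ i, α i := by
    rw [AlcoveSlice.highestRoot_eq_sum hP b (by omega) e hA hθ]
    exact Finset.sum_congr rfl fun i _ => (hα i).symm
  rw [AlcoveSlice.kpPolytope_eq_polyhedron b (by omega) e hα hθα, hθα,
    AlcoveSlice.slice_polyhedron, ← AlcoveSlice.range_kp_hyperplanes]
  subst hB
  obtain ⟨p, hp⟩ := AlcoveSlice.exists_kp_interior_point hn B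
  obtain ⟨p', hp'⟩ := AlcoveSlice.exists_slice_interior_point hn B
  have hq := AlcoveSlice.exists_kp_facet_point hn B
  rw [AlcoveSlice.boundingHyperplanes_polyhedron hp hq, AlcoveSlice.boundingHyperplanes_polyhedron
    hp' (AlcoveSlice.exists_slice_facet_point hn B), AlcoveSlice.range_slice_hyperplanes]
  refine ⟨rfl, ?_, rfl⟩
  -- Facet points also separate the hyperplanes, so the list has no repetition.
  rw [← Set.image_univ,
    Set.ncard_image_of_injective _ (AlcoveSlice.injective_hyperplane_of_facet_points hq)]
  simp [Set.ncard_univ, two_mul]
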